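/- Let $k\ge 1$ be an integer, let $T$ be a first-order theory in a language $\mathcal L$, and write $|T|=|\mathcal L|+\aleph_0$. For tuples in a model $M\models T$ and $A\subseteq M$, write $b\equiv_A b'$ if $b$ and $b'$ satisfy the same formulas with parameters from $A$. **Bounded $k$-splitting.** For tuples $a_0,\dots,a_{k-1}$ in $M\models T$ and sets $C\subseteq B\subseteq M$, the $k$-partitioned type $\operatorname{tp}(a_0;\dots;a_{k-1}/B)$ *$k$-splits over* $C$ if there are an $\mathcal L$-formula $\varphi(x_0,\dots,x_{k-1},y)$ and finite tuples $b,b'$ from $B$ such that $b\equiv_{C a_0\dots\hat a_i\dots a_{k-1}}b'$ for each $i<k$ ($\hat a_i$ means that $a_i$ is omitted), while $\varphi(a_0,\dots,a_{k-1},b)$ and $\neg\varphi(a_0,\dots,a_{k-1},b')$ hold. $T$ has *bounded $k$-splitting* if there is a cardinal $\lambda$ such that for every finite $n$, every model $M$ of $T$, all $n$-tuples $a_0,\dots,a_{k-1}$ in $M$ and every $B\subseteq M$ there is $C\subseteq B$ with $|C|<\lambda$ such that $\operatorname{tp}(a_0;\dots;a_{k-1}/B)$ does not $k$-split over $C$.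 **$k$-ineffable cardinals.** For a cardinal $\mu$, a function $f:[\mu]^k\to\mathcal P(\mu)$ is *regressive* if $f(A)\subseteq\min A$ for all $A\in[\mu]^k$. A set $X\subseteq\mu$ is *$f$-homogeneous* if $f(A)\cap\min(A\cup A')=f(A')\cap\min(A\cup A')$ for all $A,A'\in[X]^k$. A limit cardinal $\mu$ is *$k$-ineffable* if every regressive $f:[\mu]^k\to\mathcal P(\mu)$ has an $f$-homogeneous set that is stationary in $\mu$. **Theorem.** Suppose that $T$ has bounded $k$-splitting. Let $M$ be a model of $T$, $B\subseteq M$ a set of parameters, $\gamma$ an ordinal, and $\mu>|T|+|B|+|\gamma|$ a $k$-ineffable cardinal. Then for every sequence $(a_i)_{i<\mu}$ of $\gamma$-tuples of elements of $M$ there is $X\subseteq\mu$ with $|X|=\mu$ such that $(a_i)_{i\in X}$ is indiscernible over $B$; that is, for every $n<\omega$ and all $i_0<\dots<i_{n-1}$ and $j_0<\dots<j_{n-1}$ in $X$, $a_{i_0}\dots a_{i_{n-1}}\equiv_B a_{j_0}\dots a_{j_{n-1}}$. -/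

import Mathlib

open Cardinal FirstOrder

universe u v

namespace KSplitting

/-! ### Ineffability -/

section Ineffable

variable {α : Type*} [LinearOrder α]

/-- The set of all points lying strictly below every element of `A`. If `A` is a nonempty finite
set of ordinals, this is the ordinal `min A`, regarded as the set of its predecessors. -/
def belowMin (A : Finset α) : Set α := {x | ∀ a ∈ A, x < a}

/-- A function `f` from the `k`-element subsets of `α` to the power set of `α` (represented by a
function on all finite subsets, only whose values at `k`-element sets matter) is *regressive* if
`f A ⊆ min A` for every `k`-element set `A`. -/
def IsRegressive (k : ℕ) (f : Finset α → Set α) : Prop :=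
  ∀ A : Finset α, A.card = k → f A ⊆ belowMin A

/-- `X` is *`f`-homogeneous* if `f A ∩ min (A ∪ B) = f B ∩ min (A ∪ B)` for all `k`-element
subsets `A`, `B` of `X`. -/
def IsHomogeneous (k : ℕ) (f : Finset α → Set α) (X : Set α) : Prop :=
  ∀ A B : Finset α, A.card = k → B.card = k → (A : Set α) ⊆ X → (B : Set α) ⊆ X →
    f A ∩ (belowMin A ∩ belowMin B) = f B ∩ (belowMin A ∩ belowMin B)

end Ineffable

/-- A limit cardinal `μ` is *`k`-ineffable* (for `k ≥ 1`) if every regressive function from the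
`k`-element subsets of `μ` to the power set of `μ` has a homogeneous set that is stationary
in `μ`. -/
def IsIneffable (k : ℕ) (μ : Cardinal.{u}) : Prop :=
  Order.IsSuccLimit μ ∧
    ∀ f : Finset μ.ord.ToType → Set μ.ord.ToType, IsRegressive k f →
      ∃ X : Set μ.ord.ToType, IsStationary X ∧ IsHomogeneous k f X

/-! ### Types, splitting and indiscernibility -/

section ModelTheory

variable (L : FirstOrder.Language.{u, v}) {M : Type*} [L.Structure M] {ι : Type*}

/-- `b ≡_A b'`: the tuples `b` and `b'` satisfy the same formulas with parameters from `A`. -/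
def EqTypeOver (A : Set M) (b b' : ι → M) : Prop :=
  ∀ φ : L[[A]].Formula ι, φ.Realize b ↔ φ.Realize b'

/-- The `k`-partitioned type `tp(a₀; …; aₖ₋₁ / B)` *`k`-splits* over `C` if there are a formula
`φ(x₀, …, xₖ₋₁, y)` and finite tuples `b`, `b'` from `B` such that `b` and `b'` have the same type
over `C a₀ … âᵢ … aₖ₋₁` for every `i < k`, while `φ(a₀, …, aₖ₋₁, b)` and `¬ φ(a₀, …, aₖ₋₁, b')`
hold. -/
def KSplits {k : ℕ} (a : Fin k → ι → M) (B C : Set M) : Prop :=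
  ∃ (m : ℕ) (φ : L.Formula ((Fin k × ι) ⊕ Fin m)) (b b' : Fin m → M),
    (∀ j, b j ∈ B) ∧ (∀ j, b' j ∈ B) ∧
    (∀ i : Fin k, EqTypeOver L (C ∪ ⋃ (j : Fin k) (_ : j ≠ i), Set.range (a j)) b b') ∧
    φ.Realize (Sum.elim (fun p : Fin k × ι => a p.1 p.2) b) ∧
    ¬ φ.Realize (Sum.elim (fun p : Fin k × ι => a p.1 p.2) b')

/-- A sequence `(a i)` of tuples indexed by a linear order is *indiscernible over `B`* if for every
`n`, any two increasing `n`-tuples from the sequence have the same type over `B`. -/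
def IsIndiscernibleOver {I : Type*} [LinearOrder I] (B : Set M) (a : I → ι → M) : Prop :=
  ∀ (n : ℕ) (s t : Fin n → I), StrictMono s → StrictMono t →
    EqTypeOver L B (fun p : Fin n × ι => a (s p.1) p.2) (fun p : Fin n × ι => a (t p.1) p.2)

end ModelTheory

section Theory

variable {L : FirstOrder.Language.{u, v}} (T : L.Theory)

/-- `T` has *`κ`-bounded `k`-splitting for `ι`-tuples*: for every `k`-partitioned type
`tp(a₀; …; aₖ₋₁ / B)` in a model of `T`, with each `aᵢ` a tuple indexed by `ι`, there is `C ⊆ B`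
with `|C| < κ` over which the type does not `k`-split. -/
def HasBoundedSplittingFor (k : ℕ) (κ : Cardinal.{max u v}) (ι : Type*) : Prop :=
  ∀ (M : Type (max u v)) [L.Structure M] [Nonempty M] [M ⊨ T] (a : Fin k → ι → M) (B : Set M),
    ∃ C : Set M, C ⊆ B ∧ #C < κ ∧ ¬ KSplits L a B C

/-- `T` has *bounded `k`-splitting*: for some cardinal `κ`, it has `κ`-bounded `k`-splitting for
`n`-tuples for every finite `n`. -/
def HasBoundedSplitting (k : ℕ) : Prop :=
  ∃ κ : Cardinal.{max u v}, ∀ n : ℕ, HasBoundedSplittingFor T k κ (Fin n)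

end Theory

end KSplitting

/-!
# Indiscernible subsequences from bounded `k`-splitting

The argument has three parts.

*Small bases.* Whatever cardinal `κ` witnesses bounded `k`-splitting, `|T|⁺` witnesses it for finite
tuples (`HasBoundedSplittingFor.succ_card`). If some type `k`-split over every set of size at most
`|T|`, then a recursion of length `|T|⁺` would produce pairs of parameter tuples, each witnessing
splitting over all earlier ones, with one formula `φ` responsible infinitely often. By compactness
such a sequence can be stretched to a regular length above `κ`
(`IsSplittingSequence.exists_stretch`), and there it contradicts the choice of `κ`. Collecting bases
for the finite subtuples yields, for tuples indexed by `ι`, bases of size at most `|T| + |ι|`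
(`HasBoundedSplitting.exists_base`).

*Reflection.* A `k`-ineffable cardinal `μ` is regular (`IsIneffable.exists_forall_lt`). Code at most
`μ` statements about increasing `k`-tuples by elements of `μ`, and let `f A` be the set of codes
below `min A` of the statements true of `A`. This `f` is regressive; a stationary homogeneous set
can be intersected with a club of closure points of the coding, and on the intersection any two
`k`-tuples agree on all statements that concern only what lies below both
(`IsIneffable.exists_reflecting`). The statements reflected are the formulas true of
`a_{i₀}, …, a_{iₖ₋₁}` with parameters from `B` and the earlier `a_i`, and membership in a small set
of indices `D ⊆ i₀` such that the type of `(a_{i₀}; …; a_{iₖ₋₁})` over `B` and everything before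
`i₀` does not `k`-split over `B` and the tuples indexed by `D`. Since the sets `D` cohere and are all
small, their union is bounded, and beyond its bound all the types have the same base `A ⊇ B`.

*Induction on the length.* Increasing tuples of length at least `k` have the same type over `A`
(`eqTypeOver_of_not_kSplits`): by reflection the top `k` members of two such tuples may be replaced
by the same members far up, and then non-splitting reduces the claim to the tuples with one of
these top members omitted, which are shorter.
-/

namespace KSplitting

/-! ### Ineffable cardinals: regularity and reflection -/

section SetTheory

open Order Set

variable {k : ℕ} {μ : Cardinal.{u}}

lemma IsIneffable.aleph0_le (hμ : IsIneffable k μ) : ℵ₀ ≤ μ :=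
  Cardinal.aleph0_le_of_isSuccLimit hμ.1

lemma exists_gt_toType (hμ : ℵ₀ ≤ μ) (x : μ.ord.ToType) : ∃ y, x < y := by
  have := Cardinal.noMaxOrder hμ
  exact exists_gt x

/-- A stationary subset of a cardinal meets every tail. -/
lemma exists_mem_gt_of_isStationary (hμ : ℵ₀ ≤ μ) {X : Set μ.ord.ToType} (hX : IsStationary X)
    (x : μ.ord.ToType) : ∃ y ∈ X, x < y := by
  have hclub : IsClub (Ioi x) := by
    refine ⟨fun d hd hne _ a ha => ?_, fun y => ?_⟩
    · obtain ⟨z, hz⟩ := hne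
      exact lt_of_lt_of_le (hd hz) (ha.1 hz)
    · obtain ⟨z, hz⟩ := exists_gt_toType hμ (max x y)
      exact ⟨z, (le_max_left _ _).trans_lt hz, ((le_max_right _ _).trans_lt hz).le⟩
  obtain ⟨y, hy, hxy⟩ := hX hclub
  exact ⟨y, hy, hxy⟩

/-- Each member of an unbounded subset of a linear order is the first entry of an increasing
`k + 1`-tuple from that set. -/
lemma exists_strictMono_mem {I : Type*} [LinearOrder I] {X : Set I}
    (hX : ∀ x, ∃ y ∈ X, x < y) (k : ℕ) {x : I} (hx : x ∈ X) :
    ∃ s : Fin (k + 1) → I, StrictMono s ∧ (∀ i, s i ∈ X) ∧ s 0 = x := by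
  choose f hfX hf using hX
  let g : ℕ → I := fun n => f^[n] x
  have hg : StrictMono g := strictMono_nat_of_lt_succ fun n => by
    simpa [g, Function.iterate_succ_apply'] using hf _
  refine ⟨fun i => g i, fun i j h => hg h, fun i => ?_, rfl⟩
  obtain ⟨n, hn⟩ := i
  cases n with
  | zero => exact hx
  | succ n => simpa [g, Function.iterate_succ_apply'] using hfX _

/-- The regressive function used for reflection: to a `k`-element set it assigns the codes below
its minimum of those statements `p` that hold of its increasing enumeration. -/
def codeFun {I P : Type*} [LinearOrder I] (k : ℕ) (e : P → I) (H : (Fin k → I) → P → Prop)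
    (A : Finset I) : Set I :=
  {x | x ∈ belowMin A ∧ ∃ h : A.card = k, ∃ p, e p = x ∧ H (A.orderEmbOfFin h) p}

lemma isRegressive_codeFun {I P : Type*} [LinearOrder I] (e : P → I)
    (H : (Fin k → I) → P → Prop) : IsRegressive k (codeFun k e H) :=
  fun _ _ _ hx => hx.1

/-- On a homogeneous set for `codeFun`, increasing tuples agree on all statements whose codes lie
below both tuples. -/
lemma IsHomogeneous.codeFun_iff {I P : Type*} [LinearOrder I] {e : P → I}
    (he : Function.Injective e) {H : (Fin (k + 1) → I) → P → Prop} {X : Set I}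
    (hX : IsHomogeneous (k + 1) (codeFun (k + 1) e H) X) {s t : Fin (k + 1) → I}
    (hs : StrictMono s) (ht : StrictMono t) (hsX : ∀ i, s i ∈ X) (htX : ∀ i, t i ∈ X) {p : P}
    (hps : e p < s 0) (hpt : e p < t 0) : H s p ↔ H t p := by
  classical
  have card_image : ∀ {s : Fin (k + 1) → I}, StrictMono s → (Finset.univ.image s).card = k + 1 :=
    fun hs => by simp [Finset.card_image_of_injective _ hs.injective]
  have below : ∀ {s : Fin (k + 1) → I}, StrictMono s → e p < s 0 →
      e p ∈ belowMin (Finset.univ.image s) := by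
    intro s hs h a ha
    obtain ⟨i, -, rfl⟩ := Finset.mem_image.1 ha
    exact h.trans_le (hs.monotone (Fin.zero_le i))
  have mem_iff : ∀ {s : Fin (k + 1) → I}, StrictMono s → e p < s 0 →
      (e p ∈ codeFun (k + 1) e H (Finset.univ.image s) ↔ H s p) := by
    intro s hs h
    have hemb : ⇑((Finset.univ.image s).orderEmbOfFin (card_image hs)) = s :=
      (Finset.orderEmbOfFin_unique _ (fun i => Finset.mem_image_of_mem _ (Finset.mem_univ i))
        hs).symm
    constructor
    · rintro ⟨-, h', q, hq, hH⟩
      rw [he hq, hemb] at hH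
      exact hH
    · intro hH
      exact ⟨below hs h, card_image hs, p, rfl, by rwa [hemb]⟩
  have sub : ∀ {s : Fin (k + 1) → I}, (∀ i, s i ∈ X) →
      ((Finset.univ.image s : Finset I) : Set I) ⊆ X := by
    intro s h x hx
    obtain ⟨i, -, rfl⟩ := Finset.mem_image.1 (Finset.mem_coe.1 hx)
    exact h i
  have key := Set.ext_iff.1 (hX _ _ (card_image hs) (card_image ht) (sub hsX) (sub htX)) (e p)
  simp only [Set.mem_inter_iff, below hs hps, below ht hpt, and_true] at key
  rw [← mem_iff hs hps, ← mem_iff ht hpt]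
  exact key

/-- Ineffable cardinals are regular. Suppose that `S` is cofinal and is injected by `h` into the
elements below `δ`. The statement coded by `d` is taken to hold of a tuple if `d = h y` for the
chosen `y ∈ S` above the minimum of the tuple. All tuples above `δ` from a homogeneous set agree on
these statements, so they share one `y`, which contradicts that the set is unbounded. -/
lemma IsIneffable.exists_forall_lt (hμ : IsIneffable (k + 1) μ) {S : Set μ.ord.ToType}
    (hS : #S < μ) : ∃ x, ∀ y ∈ S, y < x := by
  classical
  by_contra! hcof
  have hℵ := hμ.aleph0_le
  obtain ⟨δ, ⟨h⟩⟩ : ∃ δ : μ.ord.ToType, Nonempty (S ↪ Iio δ) := by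
    obtain ⟨seg⟩ : Nonempty ((#S).ord.ToType <i μ.ord.ToType) :=
      Ordinal.type_lt_iff.1 (by simpa using hS)
    obtain ⟨e⟩ := Cardinal.eq.1 (mk_ord_toType #S).symm
    exact ⟨seg.top, ⟨fun x => ⟨seg (e x), seg.lt_top _⟩, fun x y hxy =>
      e.injective (seg.injective (congrArg Subtype.val hxy))⟩⟩
  choose c hcS hc using hcof
  let H : (Fin (k + 1) → μ.ord.ToType) → μ.ord.ToType → Prop :=
    fun s d => d = h ⟨c (s 0), hcS (s 0)⟩
  obtain ⟨X, hXs, hX⟩ := hμ.2 _ (isRegressive_codeFun id H)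
  have hunb := exists_mem_gt_of_isStationary hℵ hXs
  obtain ⟨x, hxX, hx⟩ := hunb δ
  obtain ⟨y, hyX, hy⟩ := hunb (max δ (c x))
  obtain ⟨s, hs, hsX, rfl⟩ := exists_strictMono_mem hunb k hxX
  obtain ⟨t, ht, htX, rfl⟩ := exists_strictMono_mem hunb k hyX
  have hd : (h ⟨c (s 0), hcS (s 0)⟩ : μ.ord.ToType) < δ := (h ⟨c (s 0), hcS (s 0)⟩).2
  have := (hX.codeFun_iff Function.injective_id hs ht hsX htX
    (p := (h ⟨c (s 0), hcS (s 0)⟩ : μ.ord.ToType)) (hd.trans hx)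
    (hd.trans ((le_max_left _ _).trans_lt hy))).1 rfl
  have heq : c (s 0) = c (t 0) := by
    have := h.injective (Subtype.ext this)
    exact congrArg Subtype.val this
  exact absurd (hc (t 0)) (not_le.2 (heq ▸ (le_max_right _ _).trans_lt hy))

/-- The closure points above `x₀` of a family of small sets `U j` form a club. -/
lemma IsIneffable.isClub_closurePoints (hμ : IsIneffable (k + 1) μ) (hμ' : ℵ₀ < μ)
    (U : μ.ord.ToType → Set μ.ord.ToType) (hU : ∀ j, #(U j) < μ) (x₀ : μ.ord.ToType) :
    IsClub {i | x₀ < i ∧ ∀ j < i, ∀ x ∈ U j, x < i} := by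
  refine ⟨fun d hd hne _ a ha => ⟨?_, fun j hj x hx => ?_⟩, fun y => ?_⟩
  · obtain ⟨i, hi⟩ := hne
    exact (hd hi).1.trans_le (ha.1 hi)
  · obtain ⟨i, hi, hji⟩ := (lt_isLUB_iff ha).1 hj
    exact ((hd hi).2 j hji x hx).trans_le (ha.1 hi)
  · have hreg : ∀ (f : μ.ord.ToType → μ.ord.ToType) (z : μ.ord.ToType), ∃ w, ∀ j ≤ z, f j < w := by
      intro f z
      have : #(f '' Iic z) < μ := by
        refine mk_image_le.trans_lt ?_
        obtain ⟨z', hz'⟩ := exists_gt_toType hμ.aleph0_le z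
        have hsub : Iic z ⊆ Iio z' := fun j hj => lt_of_le_of_lt hj hz'
        exact (mk_le_mk_of_subset hsub).trans_lt
          ((mk_Iio_lt z' (by simp)).trans_le (mk_ord_toType μ).le)
      obtain ⟨w, hw⟩ := hμ.exists_forall_lt this
      exact ⟨w, fun j hj => hw _ ⟨j, hj, rfl⟩⟩
    choose g hg using fun j => hμ.exists_forall_lt (hU j)
    choose F hF using hreg g
    choose S hS using exists_gt_toType hμ.aleph0_le
    -- The least strict upper bound of the iterates of `F` is closed, as `j` below it is below one
    -- of the iterates.
    let r : ℕ → μ.ord.ToType := fun n => Nat.rec (max x₀ y) (fun _ z => max (F z) (S z)) n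
    have hrange : #(range r) < μ := (mk_le_aleph0_iff.2 (countable_range r)).trans_lt hμ'
    have hex : ∃ w, ∀ n, r n < w :=
      (hμ.exists_forall_lt hrange).imp fun w hw n => hw _ ⟨n, rfl⟩
    obtain ⟨w, hw, hmin⟩ := WellFounded.has_min (wellFounded_lt (α := μ.ord.ToType))
      {w | ∀ n, r n < w} hex
    refine ⟨w, ⟨(le_max_left _ _).trans_lt (hw 0), fun j hj x hx => ?_⟩,
      ((le_max_right _ _).trans_lt (hw 0)).le⟩
    obtain ⟨n, hn⟩ : ∃ n, j ≤ r n := by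
      by_contra hcon
      push Not at hcon
      exact hmin j hcon hj
    exact (hg j x hx).trans ((hF _ j hn).trans ((le_max_left _ _).trans_lt (hw (n + 1))))

/-- Reflection: given at most `μ` statements about increasing `k`-tuples, arranged in levels of
size less than `μ`, there is an unbounded set, all of whose increasing `k`-tuples agree on every
statement of a level below them. -/
lemma IsIneffable.exists_reflecting (hμ : IsIneffable (k + 1) μ) (hμ' : ℵ₀ < μ) {P : Type u}
    (hP : #P ≤ μ) (level : μ.ord.ToType → Set P) (hlevel : ∀ j, #(level j) < μ)
    (H : (Fin (k + 1) → μ.ord.ToType) → P → Prop) :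
    ∃ X : Set μ.ord.ToType, (∀ x, ∃ y ∈ X, x < y) ∧
      ∀ s t : Fin (k + 1) → μ.ord.ToType, StrictMono s → StrictMono t →
        (∀ i, s i ∈ X) → (∀ i, t i ∈ X) → ∀ j, j < s 0 → j < t 0 → ∀ p ∈ level j,
          (H s p ↔ H t p) := by
  obtain ⟨e⟩ : Nonempty (P ↪ μ.ord.ToType) := by
    rw [← Cardinal.le_def, mk_ord_toType]; exact hP
  obtain ⟨X, hXs, hX⟩ := hμ.2 _ (isRegressive_codeFun e H)
  refine ⟨X ∩ {i | ∀ j < i, ∀ p ∈ level j, e p < i}, fun x => ?_, ?_⟩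
  · obtain ⟨y, hyX, hxy, hy⟩ := hXs (hμ.isClub_closurePoints hμ' (fun j => e '' level j)
      (fun j => mk_image_le.trans_lt (hlevel j)) x)
    exact ⟨y, ⟨hyX, fun j hj p hp => hy j hj _ ⟨p, hp, rfl⟩⟩, hxy⟩
  · intro s t hs ht hsX htX j hjs hjt p hp
    exact hX.codeFun_iff e.injective hs ht (fun i => (hsX i).1) (fun i => (htX i).1)
      ((hsX 0).2 j hjs p hp) ((htX 0).2 j hjt p hp)

/-- A set whose initial segments have size at most some `θ < μ` is bounded: as `μ` is a limit
cardinal, otherwise a subset of size `θ⁺ < μ` would be bounded by regularity. -/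
lemma IsIneffable.exists_bound (hμ : IsIneffable (k + 1) μ) {θ : Cardinal.{u}} (hθ : θ < μ)
    {D : Set μ.ord.ToType} (hD : ∀ x, ∃ y, x < y ∧ #(D ∩ Iio y : Set μ.ord.ToType) ≤ θ) :
    ∃ x, ∀ y ∈ D, y < x := by
  apply hμ.exists_forall_lt
  by_contra! hcard
  obtain ⟨D', hD', hcard'⟩ := (le_mk_iff_exists_subset (c := succ θ) (s := D)).1
    ((hμ.1.succ_lt hθ).le.trans hcard)
  obtain ⟨x, hx⟩ := hμ.exists_forall_lt (hcard'.trans_lt (hμ.1.succ_lt hθ))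
  obtain ⟨y, hxy, hy⟩ := hD x
  have hsub : D' ⊆ D ∩ Iio y := fun d hd => ⟨hD' hd, (hx d hd).trans hxy⟩
  have : #D' ≤ θ := (mk_le_mk_of_subset hsub).trans hy
  exact (lt_succ θ).not_ge (hcard' ▸ this)

/-- An unbounded subset of a regular cardinal has full size. -/
lemma IsIneffable.mk_eq_of_unbounded (hμ : IsIneffable (k + 1) μ) {X : Set μ.ord.ToType}
    (hX : ∀ x, ∃ y ∈ X, x < y) : #X = μ := by
  refine le_antisymm ((mk_set_le X).trans (mk_ord_toType μ).le) ?_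
  by_contra! hlt
  obtain ⟨x, hx⟩ := hμ.exists_forall_lt hlt
  obtain ⟨y, hy, hxy⟩ := hX x
  exact (hx y hy).not_gt hxy

end SetTheory

/-! ### Formulas with parameters -/

section Formulas

open FirstOrder.Language

variable {L : FirstOrder.Language.{u, v}} {M : Type*} [L.Structure M] {ι : Type*}

/-- Equality of types over `A`, evaluated on formulas without constants: each variable is either
assigned the same element of `A` on both sides, or corresponding entries of the two tuples. -/
theorem EqTypeOver.realize_iff {A : Set M} {b b' : ι → M} (h : EqTypeOver L A b b') {V : Type*}
    (φ : L.Formula V) {w w' : V → M}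
    (hw : ∀ x, (w x ∈ A ∧ w' x = w x) ∨ ∃ i, w x = b i ∧ w' x = b' i) :
    φ.Realize w ↔ φ.Realize w' := by
  have hg : ∀ x, ∃ y : A ⊕ ι, Sum.elim (fun c : A => (c : M)) b y = w x ∧
      Sum.elim (fun c : A => (c : M)) b' y = w' x := by
    intro x
    rcases hw x with ⟨hA, hx⟩ | ⟨i, hi, hi'⟩
    · exact ⟨Sum.inl ⟨w x, hA⟩, rfl, hx.symm⟩
    · exact ⟨Sum.inr i, hi.symm, hi'.symm⟩
  choose g hg hg' using hg
  have key : ∀ {c : ι → M} {w : V → M}, (∀ x, Sum.elim (fun c : A => (c : M)) c (g x) = w x) →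
      (Formula.Realize (BoundedFormula.constantsVarsEquiv.symm (φ.relabel g) : L[[A]].Formula ι) c ↔
        φ.Realize w) := by
    intro c w hc
    rw [Formula.Realize, ← BoundedFormula.realize_constantsVarsEquiv, Equiv.apply_symm_apply]
    exact Formula.realize_relabel.trans (by
      rw [show Sum.elim (fun a : A => (L.con a : M)) c ∘ g = w from funext hc])
  rw [← key hg, ← key hg']
  exact h _

/-- A criterion for equality of types over `A` in terms of formulas without constants, with the
elements of `A` among the values of an arbitrary assignment `p` of parameter variables. -/
theorem eqTypeOver_of_forall {A : Set M} {b b' : ι → M} {P : Type*} {p : P → M}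
    (hA : A ⊆ Set.range p)
    (h : ∀ ψ : L.Formula (P ⊕ ι), ψ.Realize (Sum.elim p b) ↔ ψ.Realize (Sum.elim p b')) :
    EqTypeOver L A b b' := by
  intro φ
  choose g hg using fun c : A => hA c.2
  have key : ∀ c : ι → M, φ.Realize c ↔
      Formula.Realize (Formula.relabel (Sum.map g id)
        (BoundedFormula.constantsVarsEquiv φ : L.Formula (A ⊕ ι))) (Sum.elim p c) := by
    intro c
    rw [Formula.Realize, ← BoundedFormula.realize_constantsVarsEquiv, Formula.realize_relabel]
    have : Sum.elim p c ∘ Sum.map g id = Sum.elim (fun a : A => (L.con a : M)) c := by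
      funext x
      rcases x with a | i
      · exact hg a
      · rfl
    rw [this]
    rfl
  rw [key, key]
  exact h _

theorem EqTypeOver.symm {A : Set M} {b b' : ι → M} (h : EqTypeOver L A b b') :
    EqTypeOver L A b' b :=
  fun φ => (h φ).symm

theorem EqTypeOver.trans {A : Set M} {b b' b'' : ι → M} (h : EqTypeOver L A b b')
    (h' : EqTypeOver L A b' b'') : EqTypeOver L A b b'' :=
  fun φ => (h φ).trans (h' φ)

theorem EqTypeOver.of_realize_iff {A : Set M} {b b' : ι → M}
    (h : ∀ ψ : L.Formula (A ⊕ ι), ψ.Realize (Sum.elim (fun a : A => (a : M)) b) ↔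
      ψ.Realize (Sum.elim (fun a : A => (a : M)) b')) :
    EqTypeOver L A b b' :=
  eqTypeOver_of_forall (by simp) h

theorem EqTypeOver.mono {A A' : Set M} {b b' : ι → M} (h : EqTypeOver L A b b') (hA : A' ⊆ A) :
    EqTypeOver L A' b b' := by
  refine .of_realize_iff fun ψ => h.realize_iff ψ ?_
  rintro (a | i)
  · exact Or.inl ⟨hA a.2, rfl⟩
  · exact Or.inr ⟨i, rfl, rfl⟩

/-- A formula can be rewritten in any set of variables that covers its free variables. -/
theorem exists_realize_comp_iff {V V' : Type*} [DecidableEq V] (φ : L.Formula V) (g : V' → V)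
    (hg : ↑(BoundedFormula.freeVarFinset φ) ⊆ Set.range g) :
    ∃ ψ : L.Formula V', ∀ w : V → M, ψ.Realize (w ∘ g) ↔ φ.Realize w := by
  choose f hf using fun x : BoundedFormula.freeVarFinset φ => hg x.2
  exact ⟨BoundedFormula.restrictFreeVar φ f, fun w =>
    BoundedFormula.realize_restrictFreeVar w fun x => congrArg w (hf x)⟩

/-- A non-splitting type treats alike any two parameter tuples, possibly infinite, that have the
same type over the base together with all but one of the tuples `a i`, for each choice of the
omitted one. -/
theorem realize_iff_of_not_kSplits {k : ℕ} {a : Fin k → ι → M} {B C : Set M}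
    (h : ¬ KSplits L a B C) {W : Type*} (φ : L.Formula ((Fin k × ι) ⊕ W)) {b b' : W → M}
    (hb : ∀ x, b x ∈ B) (hb' : ∀ x, b' x ∈ B)
    (htp : ∀ i : Fin k,
      EqTypeOver L (C ∪ ⋃ (j : Fin k) (_ : j ≠ i), Set.range (a j)) b b') :
    φ.Realize (Sum.elim (fun p : Fin k × ι => a p.1 p.2) b) ↔
      φ.Realize (Sum.elim (fun p : Fin k × ι => a p.1 p.2) b') := by
  classical
  let s : Finset W := (BoundedFormula.freeVarFinset φ).toRight
  let g : Fin s.card → W := fun i => s.equivFin.symm i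
  obtain ⟨ψ, hψ⟩ := exists_realize_comp_iff (M := M) φ (Sum.map id g : (Fin k × ι) ⊕ _ → _) (by
    rintro (x | x) hx
    · exact ⟨Sum.inl x, rfl⟩
    · exact ⟨Sum.inr (s.equivFin ⟨x, by simpa [s] using hx⟩), by simp [g]⟩)
  have hψ' : ∀ c : W → M, φ.Realize (Sum.elim (fun p : Fin k × ι => a p.1 p.2) c) ↔
      ψ.Realize (Sum.elim (fun p : Fin k × ι => a p.1 p.2) (c ∘ g)) := by
    intro c
    rw [← hψ, Sum.elim_comp_map, Function.comp_id]
  have htp' : ∀ i : Fin k, EqTypeOver L (C ∪ ⋃ (j : Fin k) (_ : j ≠ i), Set.range (a j))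
      (b ∘ g) (b' ∘ g) := fun i => .of_realize_iff fun χ => (htp i).realize_iff χ <| by
    rintro (x | x)
    · exact Or.inl ⟨x.2, rfl⟩
    · exact Or.inr ⟨g x, rfl, rfl⟩
  rw [hψ', hψ']
  by_contra hne
  -- By symmetry in `b` and `b'`, either truth value of the formula at `b` yields splitting.
  rcases (em (ψ.Realize _)).imp id (not_iff.1 hne).1 with h1 | h1
  · exact h ⟨_, ψ, b ∘ g, b' ∘ g, fun j => hb _, fun j => hb' _, htp', h1,
      fun h2 => hne ⟨fun _ => h2, fun _ => h1⟩⟩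
  · exact h ⟨_, ψ, b' ∘ g, b ∘ g, fun j => hb' _, fun j => hb _, fun i => (htp' i).symm, h1,
      fun h2 => hne ⟨fun _ => h1, fun _ => h2⟩⟩

theorem KSplits.anti {k : ℕ} {a : Fin k → ι → M} {B C C' : Set M} (h : KSplits L a B C)
    (hC : C' ⊆ C) : KSplits L a B C' := by
  obtain ⟨m, φ, b, b', hb, hb', htp, h1, h2⟩ := h
  exact ⟨m, φ, b, b', hb, hb', fun i => (htp i).mono (Set.union_subset_union_left _ hC), h1, h2⟩

end Formulas

/-! ### Compactness -/

section Compactness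

open FirstOrder.Language

variable {L : FirstOrder.Language.{u, v}} (T : L.Theory)

/-- Compactness for families of formulas with a common set of free variables. -/
theorem exists_realize_of_finite {K : Type (max u v)} {I : Type*} (G : I → L.Formula K)
    (M : Type (max u v)) [L.Structure M] [Nonempty M] [M ⊨ T]
    (hG : ∀ F : Finset I, ∃ w : K → M, ∀ i ∈ F, (G i).Realize w) :
    ∃ (N : Type (max u v)) (_ : L.Structure N) (_ : Nonempty N) (_ : N ⊨ T) (w : K → N),
      ∀ i, (G i).Realize w := by
  classical
  have hsat : ((L.lhomWithConstants K).onTheory T ∪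
      Set.range fun i => Formula.equivSentence (G i)).IsSatisfiable := by
    rw [Theory.isSatisfiable_iff_isFinitelySatisfiable]
    intro T₀ hT₀
    have : ∃ F : Finset I, (T₀ : L[[K]].Theory) ⊆
        (L.lhomWithConstants K).onTheory T ∪ (fun i => Formula.equivSentence (G i)) '' F := by
      have hR : ((T₀.filter (· ∈ Set.range fun i => Formula.equivSentence (G i)) :
          Finset L[[K]].Sentence) : Set L[[K]].Sentence) ⊆
          (fun i => Formula.equivSentence (G i)) '' Set.univ := by
        intro σ hσ
        simpa using (Finset.mem_filter.1 hσ).2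
      obtain ⟨F, -, hF⟩ := Finset.subset_set_image_iff.1 hR
      refine ⟨F, fun σ hσ => (hT₀ hσ).imp id fun h => ?_⟩
      rw [← Finset.coe_image, hF]
      exact Finset.mem_filter.2 ⟨hσ, h⟩
    obtain ⟨F, hF⟩ := this
    obtain ⟨w, hw⟩ := hG F
    let : (constantsOn K).Structure M := constantsOn.structure w
    have : M ⊨ (L.lhomWithConstants K).onTheory T ∪
        (fun i => Formula.equivSentence (G i)) '' F := by
      refine ((LHom.onTheory_model _ _).2 inferInstance).union ⟨?_⟩
      rintro _ ⟨i, hi, rfl⟩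
      rw [Formula.realize_equivSentence]
      exact hw i hi
    exact (Theory.Model.isSatisfiable M).mono hF
  obtain ⟨N⟩ := hsat
  let : L.Structure N := (L.lhomWithConstants K).reduct N
  have hN := N.is_model
  refine ⟨N, inferInstance, inferInstance,
    (LHom.onTheory_model (L.lhomWithConstants K) T).1 (hN.mono Set.subset_union_left),
    fun c => (L.con c : N), fun i => ?_⟩
  rw [← Formula.realize_equivSentence]
  exact hN.realize_of_mem _ (Or.inr ⟨i, rfl⟩)

end Compactness

/-! ### Splitting sequences -/

section SplittingSequences

open FirstOrder.Language

variable {L : FirstOrder.Language.{u, v}} {M : Type*} [L.Structure M] {ι : Type*}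

/-- A *splitting sequence* for the formula `φ` and the tuples `a`: pairs `b j`, `b' j` such that
the `j`-th pair witnesses `k`-splitting by `φ` over the entries of all earlier pairs. -/
def IsSplittingSequence {k m : ℕ} {Λ : Type*} [LinearOrder Λ]
    (φ : L.Formula ((Fin k × ι) ⊕ Fin m)) (a : Fin k → ι → M) (b b' : Λ → Fin m → M) : Prop :=
  ∀ j, φ.Realize (Sum.elim (fun p : Fin k × ι => a p.1 p.2) (b j)) ∧
    ¬ φ.Realize (Sum.elim (fun p : Fin k × ι => a p.1 p.2) (b' j)) ∧
    ∀ i : Fin k, EqTypeOver L ((⋃ l : Set.Iio j, Set.range (b l) ∪ Set.range (b' l)) ∪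
      ⋃ (i' : Fin k) (_ : i' ≠ i), Set.range (a i')) (b j) (b' j)

universe w in
theorem mk_formula_le {α : Type w} :
    #(L.Formula α) ≤ max ℵ₀ (lift.{max u v} #α + lift.{w} L.card) :=
  (mk_le_of_injective (f := fun φ : L.Formula α => (⟨0, φ⟩ : Σ n, L.BoundedFormula α n))
    fun _ _ h => by simpa using h).trans BoundedFormula.card_le

/-- If a type `k`-splits over every subset of `B` of size at most `max ℵ₀ |L|`, then a recursion
of length `(max ℵ₀ |L|)⁺` yields witnesses of splitting over all earlier witnesses, and infinitely
many of them share one formula. -/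
theorem exists_isSplittingSequence_nat {k n : ℕ} {M : Type (max u v)} [L.Structure M]
    {a : Fin k → Fin n → M} {B : Set M}
    (h : ∀ C ⊆ B, #C < Order.succ (max ℵ₀ L.card) → KSplits L a B C) :
    ∃ (m : ℕ) (φ : L.Formula ((Fin k × Fin n) ⊕ Fin m)) (b b' : ℕ → Fin m → M),
      IsSplittingSequence φ a b b' := by
  classical
  set θ : Cardinal.{max u v} := max ℵ₀ L.card with hθ
  have hθ₀ : ℵ₀ ≤ θ := le_max_left _ _
  have hreg : (Order.succ θ).IsRegular := isRegular_succ hθ₀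
  let J : Type (max u v) := (Order.succ θ).ord.ToType
  let Wt : Type (max u v) :=
    Σ m : ℕ, L.Formula ((Fin k × Fin n) ⊕ Fin m) × (Fin m → B) × (Fin m → B)
  let supp : Wt → Set M := fun w =>
    Set.range (fun x => (w.2.2.1 x : M)) ∪ Set.range (fun x => (w.2.2.2 x : M))
  let Good : Wt → Set M → Prop := fun w C =>
    w.2.1.Realize (Sum.elim (fun p : Fin k × Fin n => a p.1 p.2) (fun x => (w.2.2.1 x : M))) ∧
    ¬ w.2.1.Realize (Sum.elim (fun p : Fin k × Fin n => a p.1 p.2) (fun x => (w.2.2.2 x : M))) ∧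
    ∀ i : Fin k, EqTypeOver L (C ∪ ⋃ (i' : Fin k) (_ : i' ≠ i), Set.range (a i'))
      (fun x => (w.2.2.1 x : M)) (fun x => (w.2.2.2 x : M))
  have hex : ∀ (j : J) (prev : ∀ l, l < j → Wt),
      ∃ w, Good w (⋃ l : Set.Iio j, supp (prev l l.2)) := by
    intro j prev
    have hsub : (⋃ l : Set.Iio j, supp (prev l l.2)) ⊆ B := by
      refine Set.iUnion_subset fun l => ?_
      rintro _ (⟨x, rfl⟩ | ⟨x, rfl⟩)
      exacts [Subtype.coe_prop _, Subtype.coe_prop _]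
    have hIio : #(Set.Iio j) ≤ θ :=
      Order.lt_succ_iff.1 ((mk_Iio_lt j (by simp [J])).trans_le (mk_ord_toType _).le)
    have hcard : #(⋃ l : Set.Iio j, supp (prev l l.2)) ≤ θ := by
      refine (mk_iUnion_le _).trans (mul_le_of_le hθ₀ hIio (ciSup_le' fun l => ?_))
      have : (supp (prev l l.2)).Countable :=
        (Set.countable_range _).union (Set.countable_range _)
      exact (mk_le_aleph0_iff.2 this).trans hθ₀
    obtain ⟨m, φ, b, b', hb, hb', htp, h1, h2⟩ := h _ hsub (Order.lt_succ_of_le hcard)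
    exact ⟨⟨m, φ, fun x => ⟨b x, hb x⟩, fun x => ⟨b' x, hb' x⟩⟩, h1, h2, htp⟩
  let w : J → Wt := (wellFounded_lt (α := J)).fix fun j prev => (hex j prev).choose
  have hw : ∀ j, Good (w j) (⋃ l : Set.Iio j, supp (w l)) := by
    intro j
    have := (hex j fun l _ => w l).choose_spec
    rwa [← WellFounded.fix_eq (wellFounded_lt (α := J)) (fun j prev => (hex j prev).choose) j]
      at this
  let color : J → Σ m : ℕ, L.Formula ((Fin k × Fin n) ⊕ Fin m) := fun j => ⟨(w j).1, (w j).2.1⟩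
  have hcolor : #(Σ m : ℕ, L.Formula ((Fin k × Fin n) ⊕ Fin m)) ≤ θ := by
    rw [mk_sigma]
    refine (sum_le_lift_mk_mul_iSup _).trans (mul_le_of_le hθ₀ ?_ (ciSup_le' fun m => ?_))
    · simpa using hθ₀
    · refine mk_formula_le.trans (max_le hθ₀ (add_le_of_le hθ₀ ?_ ?_))
      · exact (lift_le_aleph0.2 mk_le_aleph0).trans hθ₀
      · simp [hθ]
  obtain ⟨⟨m, φ⟩, hφ⟩ := infinite_pigeonhole_card color (Order.succ θ) (mk_ord_toType _).ge
    hreg.aleph0_le (by rw [hreg.cof_ord]; exact Order.lt_succ_of_le hcolor)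
  have hinf : Infinite (color ⁻¹' {⟨m, φ⟩}) := infinite_iff.2 (hreg.aleph0_le.trans hφ)
  obtain ⟨r, hr⟩ : ∃ r : ℕ → J, StrictMono r ∧ ∀ i, color (r i) = ⟨m, φ⟩ := by
    let e := Infinite.natEmbedding (color ⁻¹' {⟨m, φ⟩})
    obtain ⟨g, hg | hg⟩ := exists_increasing_or_nonincreasing_subseq (· < ·) fun i => (e i : J)
    · exact ⟨fun i => e (g i), fun i j hij => hg i j hij, fun i => (e (g i)).2⟩
    · exfalso
      have hlt : ∀ i j, i < j → (e (g j) : J) < e (g i) := fun i j hij =>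
        lt_of_le_of_ne (not_lt.1 (hg i j hij)) fun heq =>
          hij.ne' (g.injective (e.injective (Subtype.ext heq)))
      exact (RelEmbedding.natGT (r := ((· < ·) : J → J → Prop)) (fun i => (e (g i) : J))
        fun i => hlt i (i + 1) i.lt_succ_self).not_wellFounded wellFounded_lt
  have hshape : ∀ i, ∃ b b' : Fin m → B, w (r i) = ⟨m, φ, b, b'⟩ := by
    intro i
    have := hr.2 i
    simp only [color] at this
    generalize w (r i) = x at this
    obtain ⟨m', φ', b, b'⟩ := x
    cases this
    exact ⟨b, b', rfl⟩
  choose b b' hbb' using hshape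
  refine ⟨m, φ, fun i x => b i x, fun i x => b' i x, fun j => ?_⟩
  have hj := hw (r j)
  rw [hbb'] at hj
  refine ⟨hj.1, hj.2.1, fun i => (hj.2.2 i).mono (Set.union_subset_union_left _ ?_)⟩
  refine Set.iUnion_subset fun l => ?_
  refine Set.subset_iUnion_of_subset ⟨r l, hr.1 l.2⟩ ?_
  rw [hbb']

/-- The set of variables that may occur in the base over which the `j`-th pair of a splitting
sequence is compared: the tuples other than the `i`-th one, and the earlier pairs. -/
abbrev BaseVar (k n m : ℕ) {Λ : Type*} [LinearOrder Λ] (i : Fin k) (j : Λ) :=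
  ({i' : Fin k // i' ≠ i} × Fin n) ⊕ ((Set.Iio j × Fin m) ⊕ (Set.Iio j × Fin m))

/-- The inclusion of the base variables into the variables for a whole splitting sequence. -/
def BaseVar.incl {k n m : ℕ} {Λ : Type*} [LinearOrder Λ] {i : Fin k} {j : Λ} :
    BaseVar k n m i j → (Fin k × Fin n) ⊕ ((Λ × Fin m) ⊕ (Λ × Fin m)) :=
  Sum.map (Prod.map (↑) id) (Sum.map (Prod.map (↑) id) (Prod.map (↑) id))

/-- The formulas that say that an assignment of the variables is a splitting sequence for `φ`. -/
def splittingFormula {k n m : ℕ} {Λ : Type*} [LinearOrder Λ]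
    (φ : L.Formula ((Fin k × Fin n) ⊕ Fin m)) :
    (Λ ⊕ Λ ⊕ Σ (j : Λ) (i : Fin k), L.Formula (BaseVar k n m i j ⊕ Fin m)) →
      L.Formula ((Fin k × Fin n) ⊕ ((Λ × Fin m) ⊕ (Λ × Fin m)))
  | .inl j => Formula.relabel (Sum.map id fun x => Sum.inl (j, x)) φ
  | .inr (.inl j) => ∼(Formula.relabel (Sum.map id fun x => Sum.inr (j, x)) φ)
  | .inr (.inr ⟨j, _, ψ⟩) =>
      Formula.iff (Formula.relabel (Sum.elim BaseVar.incl fun x => Sum.inr (Sum.inl (j, x))) ψ)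
        (Formula.relabel (Sum.elim BaseVar.incl fun x => Sum.inr (Sum.inr (j, x))) ψ)

/-- The assignment of variables given by tuples `a`, `b j`, `b' j`. -/
def assignment {k n m : ℕ} {Λ : Type*} (a : Fin k → Fin n → M) (b b' : Λ → Fin m → M) :
    (Fin k × Fin n) ⊕ ((Λ × Fin m) ⊕ (Λ × Fin m)) → M :=
  Sum.elim (fun p => a p.1 p.2) (Sum.elim (fun p => b p.1 p.2) fun p => b' p.1 p.2)

/-- By compactness, splitting sequences of length `ω` can be stretched to any linear order. Given
finitely many indices `F` in the long order, each `l` is sent to the number of elements of `F` up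
to `l`; this map is strictly below its value at `j ∈ F` for all `l < j`, in `F` or not. -/
theorem IsSplittingSequence.exists_stretch (T : L.Theory) {k n m : ℕ} {M : Type (max u v)}
    [L.Structure M] [Nonempty M] [M ⊨ T] {φ : L.Formula ((Fin k × Fin n) ⊕ Fin m)}
    {a : Fin k → Fin n → M} {b b' : ℕ → Fin m → M} (h : IsSplittingSequence φ a b b')
    (Λ : Type (max u v)) [LinearOrder Λ] :
    ∃ (N : Type (max u v)) (_ : L.Structure N) (_ : Nonempty N) (_ : N ⊨ T)
      (a : Fin k → Fin n → N) (b b' : Λ → Fin m → N), IsSplittingSequence φ a b b' := by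
  classical
  obtain ⟨N, i₁, i₂, i₃, w, hw⟩ := exists_realize_of_finite T (splittingFormula (Λ := Λ) φ) M (by
    intro F
    let idx : (Λ ⊕ Λ ⊕ Σ (j : Λ) (i : Fin k), L.Formula (BaseVar k n m i j ⊕ Fin m)) → Λ :=
      Sum.elim id (Sum.elim id Sigma.fst)
    let F' : Finset Λ := F.image idx
    let c : Λ → ℕ := fun l => (F'.filter (· ≤ l)).card
    have hc : ∀ f ∈ F, ∀ l < idx f, c l < c (idx f) := by
      intro f hf l hl
      refine Finset.card_lt_card (Finset.ssubset_iff_of_subset ?_ |>.2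
        ⟨idx f, ?_, ?_⟩)
      · exact Finset.monotone_filter_right _ fun x _ hx => hx.trans hl.le
      · exact Finset.mem_filter.2 ⟨Finset.mem_image_of_mem idx hf, le_rfl⟩
      · simpa using fun _ => hl
    refine ⟨assignment a (fun l => b (c l)) (fun l => b' (c l)), ?_⟩
    rintro (j | j | ⟨j, i, ψ⟩) hf
    · simp only [splittingFormula, Formula.realize_relabel]
      convert (h (c j)).1 using 1
      funext x
      rcases x with x | x <;> rfl
    · simp only [splittingFormula, Formula.realize_not, Formula.realize_relabel]
      convert (h (c j)).2.1 using 2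
      funext x
      rcases x with x | x <;> rfl
    · simp only [splittingFormula, Formula.realize_iff, Formula.realize_relabel]
      refine ((h (c j)).2.2 i).realize_iff ψ ?_
      rintro ((⟨i', x⟩ | ⟨l, x⟩ | ⟨l, x⟩) | x)
      · exact Or.inl ⟨Or.inr (Set.mem_iUnion₂.2 ⟨i'.1, i'.2, x, rfl⟩), rfl⟩
      · exact Or.inl ⟨Or.inl (Set.mem_iUnion.2 ⟨⟨c l, hc _ hf l l.2⟩, Or.inl ⟨x, rfl⟩⟩), rfl⟩
      · exact Or.inl ⟨Or.inl (Set.mem_iUnion.2 ⟨⟨c l, hc _ hf l l.2⟩, Or.inr ⟨x, rfl⟩⟩), rfl⟩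
      · exact Or.inr ⟨x, rfl, rfl⟩)
  refine ⟨N, i₁, i₂, i₃, fun i x => w (.inl (i, x)), fun j x => w (.inr (.inl (j, x))),
    fun j x => w (.inr (.inr (j, x))), fun j => ⟨?_, ?_, fun i => ?_⟩⟩
  · have := hw (.inl j)
    simp only [splittingFormula, Formula.realize_relabel] at this
    convert this using 1
    funext x
    rcases x with x | x <;> rfl
  · have := hw (.inr (.inl j))
    simp only [splittingFormula, Formula.realize_not, Formula.realize_relabel] at this
    convert this using 2
    funext x
    rcases x with x | x <;> rfl
  · refine eqTypeOver_of_forall (P := BaseVar k n m i j) (p := w ∘ BaseVar.incl) ?_ fun ψ => ?_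
    · rintro _ (hx | hx)
      · obtain ⟨l, ⟨x, rfl⟩ | ⟨x, rfl⟩⟩ := Set.mem_iUnion.1 hx
        · exact ⟨.inr (.inl (l, x)), rfl⟩
        · exact ⟨.inr (.inr (l, x)), rfl⟩
      · obtain ⟨i', hi', x, rfl⟩ := Set.mem_iUnion₂.1 hx
        exact ⟨.inl (⟨i', hi'⟩, x), rfl⟩
    · have := hw (.inr (.inr ⟨j, i, ψ⟩))
      simp only [splittingFormula, Formula.realize_iff, Formula.realize_relabel,
        Sum.comp_elim] at this
      exact this

end SplittingSequences

/-! ### Small bases for non-splitting -/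

section Bounds

open FirstOrder.Language

variable {L : FirstOrder.Language.{u, v}} {T : L.Theory} {k : ℕ}

/-- The bound on `k`-splitting can be taken to be `|T|⁺`: otherwise there is a splitting sequence
of length `ω`, hence one of any regular length, and a type over its members splits over every
set that does not reach its end. -/
theorem HasBoundedSplittingFor.succ_card {n : ℕ} {κ : Cardinal.{max u v}}
    (h : HasBoundedSplittingFor T k κ (Fin n)) :
    HasBoundedSplittingFor T k (Order.succ (max ℵ₀ L.card)) (Fin n) := by
  intro M _ _ _ a B
  by_contra! hcon
  obtain ⟨m, φ, b, b', hb⟩ := exists_isSplittingSequence_nat hcon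
  -- A successor cardinal, so that fewer than `κ` indices are bounded in it.
  let κ' := Order.succ (max ℵ₀ κ)
  have hreg : κ'.IsRegular := isRegular_succ (le_max_left _ _)
  obtain ⟨N, _, _, _, a, b, b', hb⟩ := hb.exists_stretch T κ'.ord.ToType
  obtain ⟨C, hCB, hCκ, hC⟩ := h N a (⋃ j, Set.range (b j) ∪ Set.range (b' j))
  apply hC
  choose l hl using fun c : C => Set.mem_iUnion.1 (hCB c.2)
  obtain ⟨j, hj⟩ : ∃ j, ∀ i ∈ Set.range l, i < j := by
    refine not_isCofinal_iff.1 fun hcof => ?_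
    have := (Order.cof_le hcof).trans mk_range_le
    rw [Ordinal.cof_toType, hreg.cof_ord] at this
    exact this.not_gt (hCκ.trans_le ((le_max_right _ _).trans (Order.le_succ _)))
  refine ⟨m, φ, b j, b' j, fun x => Set.mem_iUnion.2 ⟨j, Or.inl ⟨x, rfl⟩⟩,
    fun x => Set.mem_iUnion.2 ⟨j, Or.inr ⟨x, rfl⟩⟩,
    fun i => ((hb j).2.2 i).mono (Set.union_subset_union_left _ fun c hc => ?_),
    (hb j).1, (hb j).2.1⟩
  exact Set.mem_iUnion.2 ⟨⟨l ⟨c, hc⟩, hj _ ⟨_, rfl⟩⟩, hl ⟨c, hc⟩⟩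

/-- From finite tuples to infinite ones: the union of bases for all finite subtuples is a base
for the whole. -/
theorem HasBoundedSplitting.exists_base (hT : HasBoundedSplitting T k) {ι : Type (max u v)}
    (M : Type (max u v)) [L.Structure M] [Nonempty M] [M ⊨ T] (a : Fin k → ι → M) (B : Set M) :
    ∃ C ⊆ B, #C ≤ max (max ℵ₀ L.card) #ι ∧ ¬ KSplits L a B C := by
  classical
  obtain ⟨κ, hκ⟩ := hT
  choose C hCB hC hns using fun s : Finset ι =>
    (hκ s.card).succ_card M (fun i x => a i (s.equivFin.symm x)) B
  refine ⟨⋃ s, C s, Set.iUnion_subset hCB, ?_, ?_⟩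
  · have hinf : ℵ₀ ≤ max (max ℵ₀ L.card) #ι := le_max_of_le_left (le_max_left _ _)
    refine (mk_iUnion_le _).trans (mul_le_of_le hinf ?_ (ciSup_le' fun s => ?_))
    · rcases finite_or_infinite ι with _ | _
      · exact (mk_le_aleph0).trans hinf
      · rw [mk_finset_of_infinite]; exact le_max_right _ _
    · exact (Order.lt_succ_iff.1 (hC s)).trans (le_max_left _ _)
  · rintro ⟨m, φ, b, b', hb, hb', htp, h1, h2⟩
    let s : Finset ι := (BoundedFormula.freeVarFinset φ).toLeft.image Prod.snd
    obtain ⟨ψ, hψ⟩ := exists_realize_comp_iff (M := M) φ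
      (Sum.map (Prod.map id fun x : Fin s.card => (s.equivFin.symm x : ι)) id :
        (Fin k × Fin s.card) ⊕ Fin m → _) (by
      rintro (⟨i, x⟩ | x) hx
      · have hxs : x ∈ s := by
          simp only [s, Finset.mem_image, Finset.mem_toLeft]
          exact ⟨(i, x), hx, rfl⟩
        exact ⟨Sum.inl (i, s.equivFin ⟨x, hxs⟩), by simp⟩
      · exact ⟨Sum.inr x, rfl⟩)
    have hψ' : ∀ c : Fin m → M, φ.Realize (Sum.elim (fun p : Fin k × ι => a p.1 p.2) c) ↔
        ψ.Realize (Sum.elim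
          (fun p : Fin k × Fin s.card => a p.1 (s.equivFin.symm p.2)) c) := by
      intro c
      rw [← hψ, Sum.elim_comp_map]
      rfl
    refine hns s ⟨m, ψ, b, b', hb, hb', fun i => (htp i).mono ?_, (hψ' b).1 h1,
      fun h => h2 ((hψ' b').2 h)⟩
    refine Set.union_subset_union (Set.subset_iUnion C s) ?_
    refine Set.iUnion₂_mono fun i' _ => ?_
    rintro _ ⟨x, rfl⟩
    exact ⟨_, rfl⟩

end Bounds

/-! ### Indiscernibility from non-splitting over a fixed base -/

section Indiscernibles

open FirstOrder.Language

variable {L : FirstOrder.Language.{u, v}} {M : Type*} [L.Structure M] {ι : Type*}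

/-- If increasing `k`-tuples from an unbounded set `X` have the same type over everything below
both of them, and these types do not `k`-split over a common base `A`, then all increasing tuples
from `X` of the same length have the same type over `A`.

The proof is by induction on the length. The top `k` members of two tuples may be replaced by the
same `k` members of `X` far up; now the two tuples differ only below, and non-splitting reduces
the claim to the tuples with one of the top members omitted. -/
theorem eqTypeOver_of_not_kSplits {k : ℕ} {I : Type*} [LinearOrder I] {a : I → ι → M} {A : Set M}
    {X : Set I} (hX : ∀ x, ∃ y ∈ X, x < y) {base : I → Set M} (hA : ∀ x ∈ X, A ⊆ base x)
    (hbase : ∀ x l, l < x → Set.range (a l) ⊆ base x)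
    (hsplit : ∀ s : Fin (k + 1) → I, StrictMono s → (∀ i, s i ∈ X) →
      ¬ KSplits L (fun i => a (s i)) (base (s 0)) A)
    (htype : ∀ s t : Fin (k + 1) → I, StrictMono s → StrictMono t → (∀ i, s i ∈ X) →
      (∀ i, t i ∈ X) → s 0 ≤ t 0 →
      EqTypeOver L (base (s 0)) (fun p : Fin (k + 1) × ι => a (s p.1) p.2)
        (fun p : Fin (k + 1) × ι => a (t p.1) p.2))
    (m : ℕ) (J : Type) [LinearOrder J] [Fintype J] (hJ : Fintype.card J = m + (k + 1))
    (s t : J → I) (hs : StrictMono s) (ht : StrictMono t) (hsX : ∀ i, s i ∈ X)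
    (htX : ∀ i, t i ∈ X) :
    EqTypeOver L A (fun p : J × ι => a (s p.1) p.2) (fun p : J × ι => a (t p.1) p.2) := by
  classical
  induction m using Nat.strong_induction_on generalizing J with
  | _ m ih =>
    -- The top `k + 1` elements of `J`, and the position of each of them among these.
    let e := Fintype.orderIsoFinOfCardEq J hJ
    let τ : Fin (k + 1) → J := fun i => e (Fin.natAdd m i)
    have hτ : StrictMono τ := fun i j hij => e.strictMono (by simpa using hij)
    have hidx : ∀ x : J, ∃ i, ¬ x < τ 0 → τ i = x := by
      intro x
      by_cases hx : x < τ 0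
      · exact ⟨0, fun h => absurd hx h⟩
      · have hle : Fin.natAdd m 0 ≤ e.symm x := e.le_symm_apply.2 (not_lt.1 hx)
        have hle' : m ≤ (e.symm x : ℕ) := by simpa using Fin.le_def.1 hle
        refine ⟨⟨e.symm x - m, by omega⟩, fun _ => ?_⟩
        have : Fin.natAdd m ⟨e.symm x - m, by omega⟩ = e.symm x := Fin.ext (by simp; omega)
        simp only [τ, this, OrderIso.apply_symm_apply]
    choose idx hidx using hidx
    have hτnlt : ∀ i, ¬ τ i < τ 0 := fun i => not_lt.2 (hτ.monotone (Fin.zero_le i))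
    have hidxτ : ∀ i, idx (τ i) = i := fun i => hτ.injective (hidx _ (hτnlt i))
    -- A common tuple `u` far up.
    obtain ⟨u, hu, huX, hsu, htu⟩ : ∃ u : Fin (k + 1) → I, StrictMono u ∧ (∀ i, u i ∈ X) ∧
        (∀ x, s x < u 0) ∧ (∀ x, t x < u 0) := by
      let last : J := τ (Fin.last k)
      have hlast : ∀ x, x ≤ last := by
        intro x
        by_cases hx : x < τ 0
        · exact hx.le.trans (hτ.monotone (Fin.zero_le _))
        · rw [← hidx x hx]
          exact hτ.monotone (Fin.le_last _)
      obtain ⟨y, hyX, hy⟩ := hX (max (s last) (t last))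
      obtain ⟨u, hu, huX, rfl⟩ := exists_strictMono_mem hX k hyX
      exact ⟨u, hu, huX, fun x => (hs.monotone (hlast x)).trans_lt ((le_max_left _ _).trans_lt hy),
        fun x => (ht.monotone (hlast x)).trans_lt ((le_max_right _ _).trans_lt hy)⟩
    let mv : (J → I) → J → I := fun s x => if x < τ 0 then s x else u (idx x)
    have mv_lt : ∀ (s : J → I) {x}, x < τ 0 → mv s x = s x := fun s x hx => if_pos hx
    have mv_τ : ∀ (s : J → I) (i), mv s (τ i) = u i := fun s i => by
      simp only [mv, if_neg (hτnlt i), hidxτ]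
    have mv_mono : ∀ {s : J → I}, StrictMono s → (∀ x, s x < u 0) → StrictMono (mv s) := by
      intro s hs hsu x y hxy
      by_cases hy : y < τ 0
      · rw [mv_lt s hy, mv_lt s (hxy.trans hy)]
        exact hs hxy
      · rw [← hidx y hy, mv_τ]
        by_cases hx : x < τ 0
        · rw [mv_lt s hx]
          exact (hsu x).trans_le (hu.monotone (Fin.zero_le _))
        · rw [← hidx x hx, mv_τ]
          exact hu (hτ.lt_iff_lt.1 (by rwa [hidx x hx, hidx y hy]))
    have mv_mem : ∀ {s : J → I}, (∀ x, s x ∈ X) → ∀ x, mv s x ∈ X := by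
      intro s hsX x
      by_cases hx : x < τ 0
      · rw [mv_lt s hx]; exact hsX x
      · rw [← hidx x hx, mv_τ]; exact huX _
    have move : ∀ {s : J → I}, StrictMono s → (∀ x, s x ∈ X) → (∀ x, s x < u 0) →
        EqTypeOver L A (fun p : J × ι => a (s p.1) p.2) (fun p : J × ι => a (mv s p.1) p.2) := by
      intro s hs hsX hsu
      refine .of_realize_iff fun ψ => (htype (s ∘ τ) u (hs.comp hτ) hu (fun i => hsX _) huX
        (hsu _).le).realize_iff ψ ?_
      rintro (c | ⟨x, y⟩)
      · exact Or.inl ⟨hA _ (hsX _) c.2, rfl⟩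
      · by_cases hx : x < τ 0
        · refine Or.inl ⟨hbase _ _ (hs hx) ⟨y, rfl⟩, ?_⟩
          simp only [Sum.elim_inr, mv_lt s hx]
        · refine Or.inr ⟨(idx x, y), ?_, ?_⟩
          · simp only [Sum.elim_inr, Function.comp, hidx x hx]
          · simp only [Sum.elim_inr]
            rw [← mv_τ s, hidx x hx]
    refine (move hs hsX hsu).trans (EqTypeOver.trans ?_ (move ht htX htu).symm)
    cases m with
    | zero =>
      -- Nothing lies below the top `k + 1` elements.
      have : mv s = mv t := by
        funext x
        have hx : ¬ x < τ 0 := not_lt.2 (e.le_symm_apply.1 (Fin.le_def.2 (by simp)))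
        rw [← hidx x hx, mv_τ, mv_τ]
      rw [this]
      exact fun _ => Iff.rfl
    | succ m =>
      let W := A ⊕ ({x : J // x < τ 0} × ι)
      let par : (J → I) → W → M := fun s => Sum.elim (fun c => (c : M)) fun p => a (s p.1) p.2
      have hpar : ∀ {s : J → I}, (∀ x, s x < u 0) → ∀ w, par s w ∈ base (u 0) := by
        rintro s hsu (c | ⟨x, y⟩)
        · exact hA _ (huX 0) c.2
        · exact hbase _ _ (hsu x) ⟨y, rfl⟩
      refine .of_realize_iff fun ψ => ?_
      let g : A ⊕ (J × ι) → (Fin (k + 1) × ι) ⊕ W := Sum.elim (fun c => Sum.inr (Sum.inl c))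
        fun p => if hx : p.1 < τ 0 then Sum.inr (Sum.inr (⟨p.1, hx⟩, p.2)) else
          Sum.inl (idx p.1, p.2)
      have hg : ∀ s : J → I, Sum.elim (fun p : Fin (k + 1) × ι => a (u p.1) p.2) (par s) ∘ g =
          Sum.elim (fun c : A => (c : M)) fun p : J × ι => a (mv s p.1) p.2 := by
        intro s
        funext x
        rcases x with c | ⟨x, y⟩
        · rfl
        · by_cases hx : x < τ 0
          · simp [g, hx, par, mv]
          · simp [g, hx, mv]
      rw [← hg s, ← hg t, ← Formula.realize_relabel, ← Formula.realize_relabel]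
      refine realize_iff_of_not_kSplits (hsplit u hu huX) _ (hpar hsu) (hpar htu) fun i => ?_
      -- Omitting the `i`-th of the top members, the induction hypothesis applies.
      have hcard : Fintype.card {x : J // x ≠ τ i} = m + (k + 1) := by
        rw [Fintype.card_subtype_compl, Fintype.card_subtype_eq]
        omega
      have IH := ih m m.lt_succ_self {x : J // x ≠ τ i} hcard (fun x => mv s x) (fun x => mv t x)
        (fun x y h => mv_mono hs hsu h) (fun x y h => mv_mono ht htu h)
        (fun x => mv_mem hsX x) (fun x => mv_mem htX x)
      refine eqTypeOver_of_forall (P := A ⊕ ({j // j ≠ i} × ι))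
        (p := Sum.elim (fun c => (c : M)) fun q => a (u q.1) q.2) ?_ fun χ => IH.realize_iff χ ?_
      · rintro _ (hx | hx)
        · exact ⟨Sum.inl ⟨_, hx⟩, rfl⟩
        · obtain ⟨j, hj, y, rfl⟩ := Set.mem_iUnion₂.1 hx
          exact ⟨Sum.inr (⟨j, hj⟩, y), rfl⟩
      · rintro ((c | ⟨⟨j, hj⟩, y⟩) | (c | ⟨⟨x, hx⟩, y⟩))
        · exact Or.inl ⟨c.2, rfl⟩
        · refine Or.inr ⟨(⟨τ j, fun h => hj (hτ.injective h)⟩, y), ?_, ?_⟩ <;>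
            simp only [Sum.elim_inl, Sum.elim_inr, mv_τ]
        · exact Or.inl ⟨c.2, rfl⟩
        · refine Or.inr ⟨(⟨x, fun h => hτnlt i (h ▸ hx)⟩, y), ?_, ?_⟩ <;>
            simp only [Sum.elim_inr, par, mv_lt _ hx]

/-- Short tuples extend to long ones, so agreement on the types of long tuples suffices. -/
theorem isIndiscernibleOver_of_card_add {k : ℕ} {I : Type*} [LinearOrder I] [Nonempty I]
    {a : I → ι → M} {A : Set M} {X : Set I} (hX : ∀ x, ∃ y ∈ X, x < y)
    (h : ∀ (m : ℕ) (J : Type) [LinearOrder J] [Fintype J], Fintype.card J = m + (k + 1) →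
      ∀ s t : J → I, StrictMono s → StrictMono t → (∀ i, s i ∈ X) → (∀ i, t i ∈ X) →
      EqTypeOver L A (fun p : J × ι => a (s p.1) p.2) (fun p : J × ι => a (t p.1) p.2)) :
    IsIndiscernibleOver L A (fun i : X => a i) := by
  intro n s t hs ht
  have hext : ∀ {s : Fin n → X}, StrictMono s → ∃ s' : Fin (n + (k + 1)) → I, StrictMono s' ∧
      (∀ i, s' i ∈ X) ∧ ∀ i : Fin n, s' (Fin.castAdd (k + 1) i) = s i := by
    intro s hs
    obtain ⟨u, hu, huX, hsu⟩ : ∃ u : Fin (k + 1) → I, StrictMono u ∧ (∀ i, u i ∈ X) ∧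
        ∀ i, (s i : I) < u 0 := by
      obtain ⟨z, hz⟩ : ∃ z, ∀ i, (s i : I) ≤ z := by
        cases n with
        | zero => exact ⟨Classical.arbitrary I, fun i => i.elim0⟩
        | succ n => exact ⟨s (Fin.last n), fun i => hs.monotone (Fin.le_last i)⟩
      obtain ⟨y, hyX, hy⟩ := hX z
      obtain ⟨u, hu, huX, rfl⟩ := exists_strictMono_mem hX k hyX
      exact ⟨u, hu, huX, fun i => (hz i).trans_lt hy⟩
    refine ⟨Fin.append (fun i => (s i : I)) u, ?_, fun i => ?_, fun i => by simp⟩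
    · intro i j hij
      induction i using Fin.addCases with
      | left i =>
        induction j using Fin.addCases with
        | left j => simpa using hs (show i < j from hij)
        | right j => simpa using (hsu i).trans_le (hu.monotone (Fin.zero_le j))
      | right i =>
        induction j using Fin.addCases with
        | left j => exact absurd hij (by simp [Fin.lt_def]; omega)
        | right j => simpa using hu (show i < j by simpa using hij)
    · induction i using Fin.addCases with
      | left i => simp
      | right i => simpa using huX i
  obtain ⟨s', hs', hsX, hss⟩ := hext hs
  obtain ⟨t', ht', htX, htt⟩ := hext ht
  refine .of_realize_iff fun ψ => (h n (Fin (n + (k + 1))) (by simp) s' t' hs' ht' hsX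
    htX).realize_iff ψ ?_
  rintro (c | ⟨i, y⟩)
  · exact Or.inl ⟨c.2, rfl⟩
  · exact Or.inr ⟨(Fin.castAdd (k + 1) i, y), by simp [hss], by simp [htt]⟩

end Indiscernibles

/-! ### Types over initial segments of a sequence -/

section Main

open FirstOrder.Language

variable {L : FirstOrder.Language.{u, v}} {M : Type*} {ι I : Type*}

/-- The set `B` together with the entries of all tuples `a l` with `l ∈ D`. -/
def baseSet (B : Set M) (a : I → ι → M) (D : Set I) : Set M :=
  B ∪ ⋃ l ∈ D, Set.range (a l)

theorem baseSet_mono {B : Set M} {a : I → ι → M} {D D' : Set I} (h : D ⊆ D') :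
    baseSet B a D ⊆ baseSet B a D' :=
  Set.union_subset_union_right _ (Set.biUnion_subset_biUnion_left h)

theorem range_subset_baseSet {B : Set M} {a : I → ι → M} {D : Set I} {l : I} (h : l ∈ D) :
    Set.range (a l) ⊆ baseSet B a D :=
  fun _ hx => Or.inr (Set.mem_biUnion h hx)

/-- Bounded `k`-splitting, with the base given by a set of indices. -/
theorem HasBoundedSplitting.exists_index_base {T : L.Theory} {k : ℕ}
    (hT : HasBoundedSplitting T k) {M ι I : Type (max u v)} [L.Structure M] [Nonempty M] [M ⊨ T]
    (B : Set M) (a : I → ι → M)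
    (c : Fin k → ι → M) (D₀ : Set I) :
    ∃ D ⊆ D₀, #D ≤ max (max ℵ₀ L.card) #ι ∧ ¬ KSplits L c (baseSet B a D₀) (baseSet B a D) := by
  obtain ⟨C, hCB, hC, hns⟩ := hT.exists_base M c (baseSet B a D₀)
  have hmem : ∀ x : (C \ B : Set M), ∃ l : D₀, (x : M) ∈ Set.range (a l) := by
    rintro ⟨x, hxC, hxB⟩
    obtain ⟨l, hl, hx⟩ := Set.mem_iUnion₂.1 ((hCB hxC).resolve_left hxB)
    exact ⟨⟨l, hl⟩, hx⟩
  choose f hf using hmem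
  refine ⟨Set.range fun x => (f x : I), ?_, mk_range_le.trans
    ((mk_le_mk_of_subset Set.sdiff_subset).trans hC), fun h => hns (h.anti fun x hx => ?_)⟩
  · rintro _ ⟨x, rfl⟩
    exact (f x).2
  · by_cases hxB : x ∈ B
    · exact Or.inl hxB
    · exact range_subset_baseSet (Set.mem_range_self (⟨x, hx, hxB⟩ : (C \ B : Set M)))
        (hf ⟨x, hx, hxB⟩)

/-- To compare types over everything below `x`, it suffices to consider parameters from tuples up
to some `j < x`, one `j` at a time: a formula involves only finitely many tuples. -/
theorem eqTypeOver_baseSet_Iio [L.Structure M] [LinearOrder I] {B : Set M} {a : I → ι → M}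
    {x j₀ : I} (hj₀ : j₀ < x) {κ : Type*} {c c' : κ → M}
    (h : ∀ j < x, ∀ φ : L.Formula (B ⊕ (κ ⊕ (Set.Iic j × ι))),
      φ.Realize (Sum.elim (fun e => (e : M)) (Sum.elim c fun p => a p.1 p.2)) ↔
        φ.Realize (Sum.elim (fun e => (e : M)) (Sum.elim c' fun p => a p.1 p.2))) :
    EqTypeOver L (baseSet B a (Set.Iio x)) c c' := by
  classical
  refine eqTypeOver_of_forall (P := B ⊕ (Set.Iio x × ι))
    (p := Sum.elim (fun e => (e : M)) fun p => a p.1 p.2) ?_ fun ψ => ?_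
  · rintro y (hy | hy)
    · exact ⟨Sum.inl ⟨y, hy⟩, rfl⟩
    · obtain ⟨l, hl, z, rfl⟩ := Set.mem_iUnion₂.1 hy
      exact ⟨Sum.inr (⟨l, hl⟩, z), rfl⟩
  · let S : Finset (Set.Iio x) :=
      insert ⟨j₀, hj₀⟩ ((BoundedFormula.freeVarFinset ψ).toLeft.toRight.image Prod.fst)
    obtain ⟨j, -, hj⟩ := S.exists_max_image id ⟨_, Finset.mem_insert_self _ _⟩
    let g : B ⊕ (κ ⊕ (Set.Iic j.1 × ι)) → (B ⊕ (Set.Iio x × ι)) ⊕ κ :=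
      Sum.elim (fun e => Sum.inl (Sum.inl e)) (Sum.elim Sum.inr fun p =>
        Sum.inl (Sum.inr (⟨p.1, lt_of_le_of_lt p.1.2 j.2⟩, p.2)))
    obtain ⟨φ, hφ⟩ := exists_realize_comp_iff (M := M) ψ g (by
      rintro ((e | ⟨l, y⟩) | y) hy
      · exact ⟨Sum.inl e, rfl⟩
      · have hl : l ≤ j := hj l (Finset.mem_insert_of_mem (Finset.mem_image.2
          ⟨(l, y), by simpa using hy, rfl⟩))
        exact ⟨Sum.inr (Sum.inr (⟨l, hl⟩, y)), rfl⟩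
      · exact ⟨Sum.inr (Sum.inl y), rfl⟩)
    have hg : ∀ c : κ → M,
        Sum.elim (Sum.elim (fun e : B => (e : M)) fun p : Set.Iio x × ι => a p.1 p.2) c ∘ g =
          Sum.elim (fun e : B => (e : M))
            (Sum.elim c fun p : Set.Iic j.1 × ι => a p.1 p.2) := by
      intro c
      funext y
      rcases y with e | y | y <;> rfl
    rw [← hφ, ← hφ, hg, hg]
    exact h j j.2 φ

end Main

end KSplitting

/-! ### Extracting an indiscernible subsequence -/

open KSplitting FirstOrder.Language in
theorem mainTheorem1 {L : FirstOrder.Language.{u, v}} (T : L.Theory)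
    (k : ℕ) (hk : 1 ≤ k) (hT : KSplitting.HasBoundedSplitting T k)
    (M : Type (max u v)) [L.Structure M] [Nonempty M] [M ⊨ T]
    (B : Set M) (γ : Ordinal.{max u v}) (μ : Cardinal.{max u v})
    (hμ : KSplitting.IsIneffable k μ)
    (hlt : max ℵ₀ L.card + #B + γ.card < μ)
    (a : μ.ord.ToType → γ.ToType → M) :
    ∃ X : Set μ.ord.ToType, #X = μ ∧
      KSplitting.IsIndiscernibleOver L B (fun i : X => a i) := by
  obtain ⟨k, rfl⟩ := Nat.exists_eq_add_of_le' hk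
  -- The cardinals that have to be compared with `μ`.
  have hLμ : max ℵ₀ L.card < μ :=
    ((self_le_add_right _ _).trans (self_le_add_right _ _)).trans_lt hlt
  have hBμ : #B < μ := ((self_le_add_left _ _).trans (self_le_add_right _ _)).trans_lt hlt
  have hγμ : #γ.ToType < μ := by
    rw [mk_toType]; exact (self_le_add_left _ _).trans_lt hlt
  have hμ₀ : ℵ₀ < μ := (le_max_left _ _).trans_lt hLμ
  have hformula : ∀ V : Type (max u v), #V < μ → #(L.Formula V) < μ := fun V hV =>
    mk_formula_le.trans_lt (max_lt hμ₀ (add_lt_of_lt hμ₀.le (by simpa using hV)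
      (by simpa using (le_max_right _ _).trans_lt hLμ)))
  have : Nonempty μ.ord.ToType := mk_ne_zero_iff.1 (by simpa using (aleph0_pos.trans hμ₀).ne')
  have hIic : ∀ j : μ.ord.ToType, #(Set.Iic j) < μ := by
    intro j
    obtain ⟨j', hj'⟩ := exists_gt_toType hμ₀.le j
    have hsub : Set.Iic j ⊆ Set.Iio j' := fun i hi => lt_of_le_of_lt hi hj'
    exact (mk_le_mk_of_subset hsub).trans_lt
      ((mk_Iio_lt j' (by simp)).trans_le (mk_ord_toType μ).le)
  have hFin : #(Fin (k + 1) × γ.ToType) < μ := by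
    rw [mk_prod]
    exact mul_lt_of_lt hμ₀.le (by simpa using (natCast_lt_aleph0 (n := k + 1)).trans hμ₀)
      (by simpa using hγμ)
  have hvars : ∀ j : μ.ord.ToType,
      #(B ⊕ ((Fin (k + 1) × γ.ToType) ⊕ (Set.Iic j × γ.ToType))) < μ := by
    intro j
    rw [mk_sum, mk_sum, mk_prod (Set.Iic j)]
    simp only [lift_id]
    exact add_lt_of_lt hμ₀.le hBμ (add_lt_of_lt hμ₀.le hFin (mul_lt_of_lt hμ₀.le (hIic j) hγμ))
  -- Small sets of indices over which the types of increasing tuples do not split.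
  choose D hDsub hDcard hD using fun s : Fin (k + 1) → μ.ord.ToType =>
    hT.exists_index_base B a (fun i => a (s i)) (Set.Iio (s 0))
  -- The statements to be reflected: the type of a tuple with parameters below it, and `D`.
  let P : Type (max u v) := L.Formula
    (B ⊕ ((Fin (k + 1) × γ.ToType) ⊕ (μ.ord.ToType × γ.ToType))) ⊕ μ.ord.ToType
  let H : (Fin (k + 1) → μ.ord.ToType) → P → Prop := fun s => Sum.elim
    (fun φ => φ.Realize (Sum.elim (fun e => (e : M))
      (Sum.elim (fun p => a (s p.1) p.2) fun p => a p.1 p.2))) (fun d => d ∈ D s)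
  let up : ∀ j : μ.ord.ToType,
      L.Formula (B ⊕ ((Fin (k + 1) × γ.ToType) ⊕ (Set.Iic j × γ.ToType))) →
      L.Formula (B ⊕ ((Fin (k + 1) × γ.ToType) ⊕ (μ.ord.ToType × γ.ToType))) := fun j =>
    Formula.relabel (Sum.map id (Sum.map id (Prod.map (↑) id)))
  let level : μ.ord.ToType → Set P := fun j => Sum.inl '' Set.range (up j) ∪ Sum.inr '' Set.Iic j
  have hlevel : ∀ j, #(level j) < μ := fun j =>
    (mk_union_le _ _).trans_lt (add_lt_of_lt hμ₀.le
      (mk_image_le.trans_lt (mk_range_le.trans_lt (hformula _ (hvars j))))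
      (mk_image_le.trans_lt (hIic j)))
  have hP : #P ≤ μ := by
    simp only [P]
    rw [mk_sum, lift_id, lift_id, mk_ord_toType]
    refine add_le_of_le hμ₀.le (mk_formula_le.trans (max_le hμ₀.le (add_le_of_le hμ₀.le ?_ ?_)))
      le_rfl
    · rw [lift_id, mk_sum, mk_sum, mk_prod μ.ord.ToType]
      simp only [lift_id, mk_ord_toType]
      exact add_le_of_le hμ₀.le hBμ.le (add_le_of_le hμ₀.le hFin.le
        (mul_le_of_le hμ₀.le le_rfl hγμ.le))
    · rw [lift_id]
      exact (le_max_right _ _).trans hLμ.le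
  obtain ⟨X, hX, hXH⟩ := hμ.exists_reflecting hμ₀ hP level hlevel H
  -- The union of the sets `D s` is bounded, as its initial segments are among the `D s`.
  obtain ⟨d₀, hd₀⟩ := hμ.exists_bound (max_lt hLμ hγμ)
    (D := ⋃ s : {s : Fin (k + 1) → μ.ord.ToType // StrictMono s ∧ ∀ i, s i ∈ X}, D s) (by
      intro x
      obtain ⟨y, hyX, hxy⟩ := hX x
      obtain ⟨s, hs, hsX, rfl⟩ := exists_strictMono_mem hX k hyX
      refine ⟨s 0, hxy, (mk_le_mk_of_subset ?_).trans (hDcard s)⟩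
      rintro d ⟨hd, hds⟩
      obtain ⟨⟨t, ht, htX⟩, hdt⟩ := Set.mem_iUnion.1 hd
      exact (hXH t s ht hs htX hsX d (hDsub t hdt) hds (Sum.inr d)
        (Or.inr ⟨d, Set.self_mem_Iic, rfl⟩)).1 hdt)
  let X' : Set μ.ord.ToType := X ∩ Set.Ioi d₀
  have hX' : ∀ x, ∃ y ∈ X', x < y := by
    intro x
    obtain ⟨y, hyX, hy⟩ := hX (max x d₀)
    exact ⟨y, ⟨hyX, (le_max_right _ _).trans_lt hy⟩, (le_max_left _ _).trans_lt hy⟩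
  let A : Set M := baseSet B a (⋃ s : {s : Fin (k + 1) → μ.ord.ToType //
    StrictMono s ∧ ∀ i, s i ∈ X}, D s)
  refine ⟨X', hμ.mk_eq_of_unbounded hX', ?_⟩
  have key : IsIndiscernibleOver L A (fun i : X' => a i) := by
    refine isIndiscernibleOver_of_card_add (k := k) hX' fun m J _ _ hJ s t hs ht hsX htX =>
      eqTypeOver_of_not_kSplits hX' (base := fun x => baseSet B a (Set.Iio x)) ?_ ?_ ?_ ?_
        m J hJ s t hs ht hsX htX
    · exact fun x hx => baseSet_mono fun d hd => (hd₀ d hd).trans hx.2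
    · exact fun x l hl => range_subset_baseSet hl
    · exact fun s hs hsX h => hD s (h.anti (baseSet_mono
        (Set.subset_iUnion_of_subset ⟨s, hs, fun i => (hsX i).1⟩ subset_rfl)))
    · intro s t hs ht hsX htX hst
      refine eqTypeOver_baseSet_Iio (hsX 0).2 fun j hj φ => ?_
      have := hXH s t hs ht (fun i => (hsX i).1) (fun i => (htX i).1) j hj (hj.trans_le hst)
        (Sum.inl (up j φ)) (Or.inl ⟨_, ⟨φ, rfl⟩, rfl⟩)
      simp only [H, up, Sum.elim_inl, Formula.realize_relabel, Sum.elim_comp_map,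
        Function.comp_id] at this
      exact this
  exact fun n s t hs ht => (key n s t hs ht).mono Set.subset_union_left
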